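/- Let $d\ge 2$ and $h_1\ge 1$ be integers. Then there exists a $d$-dimensional integral simplicial convex polytope $\mathcal P\subset\mathbb R^d$ (that is, all vertices of $\mathcal P$ lie in $\mathbb Z^d$ and every proper face of $\mathcal P$ is a simplex) such that every facet of $\mathcal P$ has normalized volume $1$ and the $h$-vector of the boundary complex of $\mathcal P$ is $$(h_0,h_1,\ldots,h_{d-1},h_d)=(1,h_1,h_1,\ldots,h_1,1)\in\mathbb Z^{d+1}.$$ Here the normalized volume of an integral polytope $\mathcal F\subset\mathbb R^d$ of dimension $e$ is $\delta_0+\delta_1+\cdots+\delta_e$, where the integers $\delta_i$ are defined by $$(1-\lambda)^{e+1}\Bigl[1+\sum_{n\ge 1}\bigl|n\mathcal F\cap\mathbb Z^d\bigr|\lambda^n\Bigr]=\sum_{i\ge 0}\delta_i\lambda^i .$$ The boundary complex of $\mathcal P$ is the simplicial complex whose faces are the vertex sets of the proper faces of $\mathcal P$ (including $\emptyset$), and its $h$-vector is defined by $\sum_{i=0}^{d} f_{i-1}(x-1)^{d-i}=\sum_{i=0}^{d}h_i x^{d-i}$, where $f_{i-1}$ is the number of its faces with exactly $i$ vertices. 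-/

import Mathlib

open scoped Pointwise

noncomputable section

namespace LatticePolytope

/-- A convex polytope in `ℝ^N`: the convex hull of a finite set of points. -/
def IsPolytope {N : ℕ} (P : Set (Fin N → ℝ)) : Prop :=
  ∃ s : Finset (Fin N → ℝ), P = convexHull ℝ (s : Set (Fin N → ℝ))

/-- The vertices of a polytope. -/
def vertices {N : ℕ} (P : Set (Fin N → ℝ)) : Set (Fin N → ℝ) := P.extremePoints ℝ

/-- An integral polytope: every vertex has integer coordinates. -/
def IsIntegralPolytope {N : ℕ} (P : Set (Fin N → ℝ)) : Prop :=
  IsPolytope P ∧ ∀ v ∈ vertices P, ∃ z : Fin N → ℤ, v = fun i => (z i : ℝ)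

/-- The dimension of a nonempty convex set: the dimension of its affine hull. -/
def dimension {N : ℕ} (P : Set (Fin N → ℝ)) : ℕ := Module.finrank ℝ (vectorSpan ℝ P)

/-- A simplex: the convex hull of an affinely independent finite set
(the empty face is the simplex without vertices). -/
def IsSimplex {N : ℕ} (F : Set (Fin N → ℝ)) : Prop :=
  ∃ s : Finset (Fin N → ℝ), AffineIndependent ℝ ((↑) : s → (Fin N → ℝ)) ∧
    F = convexHull ℝ (s : Set (Fin N → ℝ))

/-- A proper face of `P`: a face (the empty set, or the set of points of `P` at which some linear
functional is maximal on `P`) other than `P` itself. -/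
def IsProperFace {N : ℕ} (P F : Set (Fin N → ℝ)) : Prop := IsExposed ℝ P F ∧ F ≠ P

/-- A facet: a nonempty proper face of codimension one in `P`. -/
def IsFacet {N : ℕ} (P F : Set (Fin N → ℝ)) : Prop :=
  IsProperFace P F ∧ F.Nonempty ∧ dimension F + 1 = dimension P

/-- A simplicial polytope: every proper face is a simplex. -/
def IsSimplicialPolytope {N : ℕ} (P : Set (Fin N → ℝ)) : Prop :=
  IsPolytope P ∧ ∀ F, IsProperFace P F → IsSimplex F

/-- The number `i(P, n) = |nP ∩ ℤ^N|` of lattice points in the `n`-th dilate of `P`. -/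
def latticeCount {N : ℕ} (P : Set (Fin N → ℝ)) (n : ℕ) : ℕ :=
  Set.ncard {z : Fin N → ℤ | (fun i => (z i : ℝ)) ∈ (n : ℝ) • P}

/-- The Ehrhart series `1 + ∑_{n ≥ 1} i(P, n) λ^n`. -/
def ehrhartSeries {N : ℕ} (P : Set (Fin N → ℝ)) : PowerSeries ℤ :=
  PowerSeries.mk fun n => if n = 0 then 1 else (latticeCount P n : ℤ)

/-- The entries `δ_i` of the `δ`-vector of `P`, given by
`(1 - λ)^(dim P + 1) * (1 + ∑_{n ≥ 1} i(P, n) λ^n) = ∑_i δ_i λ^i`. -/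
def delta {N : ℕ} (P : Set (Fin N → ℝ)) (i : ℕ) : ℤ :=
  PowerSeries.coeff i
    ((1 - (PowerSeries.X : PowerSeries ℤ)) ^ (dimension P + 1) * ehrhartSeries P)

/-- The normalized volume `δ_0 + δ_1 + ⋯ + δ_{dim P}`, with respect to the lattice points of the
affine hull of `P`. -/
def normalizedVolume {N : ℕ} (P : Set (Fin N → ℝ)) : ℤ :=
  ∑ i ∈ Finset.range (dimension P + 1), delta P i

/-- The boundary complex of a simplicial polytope, as an abstract simplicial complex on the vertices
of `P`: its faces are the vertex sets of the proper faces of `P`, the empty face included. -/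
def boundaryComplex {N : ℕ} (P : Set (Fin N → ℝ)) : Set (Finset (Fin N → ℝ)) :=
  {W | ∃ F, IsProperFace P F ∧ (W : Set (Fin N → ℝ)) = vertices F}

/-- The number of faces of a simplicial complex with exactly `j` vertices; in the usual notation
this is `f_{j-1}`. -/
def faceCount {E : Type*} (K : Set (Finset E)) (j : ℕ) : ℕ :=
  Set.ncard {W : Finset E | W ∈ K ∧ W.card = j}

/-- The entry `h_i` of the `h`-vector of a simplicial complex `K` of dimension `d - 1`. Equivalently,
`∑_{j ≤ d} f_{j-1} (x - 1)^(d-j) = ∑_{i ≤ d} h_i x^(d-i)`. -/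
def hVector {E : Type*} (K : Set (Finset E)) (d i : ℕ) : ℤ :=
  ∑ j ∈ Finset.range (i + 1),
    (-1) ^ (i - j) * ((d - j).choose (i - j) : ℤ) * (faceCount K j : ℤ)

end LatticePolytope

end

/-! ### Convex hulls of finite families and their exposed faces. -/

namespace LatticePolytope

variable {ι : Type*} [Fintype ι] {N : ℕ}

/-! Write d = m + 1 and k = h₁. The witness is the convex hull of the m unit vectors e_s in the last
m coordinates and the k + 1 points (j, j², …, j²), 0 ≤ j ≤ k, on a parabola through the origin.

An affine function on ℝ^d is recorded by its values α_s at the e_s and by the quadratic q(j) = G j²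
+ D j + c of its values on the parabola, subject to the single relation ∑ α_s = G + m c. Proper
faces correspond to the zero sets, other than the set of all generators, of such data with α ≥ 0 and
q(j) ≥ 0 for j = 0, …, k; where no datum vanishes the face is empty. If some α_s is positive, q can
vanish nowhere, at one j, or at two consecutive j. If all α_s vanish, then G = -m c ≤ 0, so q is
concave and can vanish only at one end of the parabola. Hence the boundary complex is the join of a
path on k + 1 vertices with the boundary of an (m-1)-simplex, capped at both ends by a full simplex
(`isProperFace_stackedPolytope_iff`).

On every such index set, weights with integral total and integral weighted sum are integral
(`isUnimodularOn_stackedVertex`). This one property gives affine independence, identifies the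
vertices of each face, and makes the Ehrhart series of a nonempty face equal to that of a standard
simplex, so its normalized volume is 1.

Counting faces gives f_{j-1} = C(d, j) + k C(d, j-1) - (k-1)[j = d]. The three terms contribute (1,
0, …, 0), k (0, 1, …, 1) and -(k-1) (0, …, 0, 1) to the h-vector. -/

theorem mem_convexHull_image_iff (v : ι → Fin N → ℝ) (T : Finset ι) (x : Fin N → ℝ) :
    x ∈ convexHull ℝ (v '' (T : Set ι)) ↔
      ∃ c : ι → ℝ, (∀ i, 0 ≤ c i) ∧ (∀ i, i ∉ T → c i = 0) ∧ ∑ i, c i = 1 ∧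
        ∑ i, c i • v i = x := by
  classical
  constructor
  · intro hx
    have hsub : convexHull ℝ (v '' (T : Set ι)) ⊆
        {x | ∃ c : ι → ℝ, (∀ i, 0 ≤ c i) ∧ (∀ i, i ∉ T → c i = 0) ∧ ∑ i, c i = 1 ∧
        ∑ i, c i • v i = x} := by
      apply convexHull_min
      · rintro _ ⟨i, hi, rfl⟩
        refine ⟨Pi.single i 1, fun j => ?_, fun j hj => ?_, by simp, ?_⟩
        · by_cases h : j = i
          · subst h; simp
          · simp [h]
        · have : j ≠ i := by rintro rfl; exact hj hi
          simp [this]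
        · rw [Finset.sum_eq_single i] <;> simp +contextual
      · rintro x ⟨c, hc, hcT, hc1, rfl⟩ y ⟨c', hc', hcT', hc1', rfl⟩ a b ha hb hab
        refine ⟨fun i => a * c i + b * c' i, fun i => ?_, fun i hi => ?_, ?_, ?_⟩
        · have := hc i; have := hc' i; positivity
        · simp [hcT i hi, hcT' i hi]
        · rw [Finset.sum_add_distrib, ← Finset.mul_sum, ← Finset.mul_sum, hc1, hc1']; linarith
        · simp only [add_smul, mul_smul, Finset.sum_add_distrib, Finset.smul_sum]
    exact hsub hx
  · rintro ⟨c, hc, hcT, hc1, rfl⟩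
    have h0 : ∀ i ∈ Finset.univ, i ∉ T → c i • v i = 0 := fun i _ hi => by simp [hcT i hi]
    rw [← Finset.sum_subset (Finset.subset_univ T) h0]
    refine (convex_convexHull ℝ _).sum_mem (fun i _ => hc i) ?_ ?_
    · rw [← hc1]
      exact Finset.sum_subset (Finset.subset_univ T) fun i _ hi => hcT i hi
    · exact fun i hi => subset_convexHull ℝ _ ⟨i, hi, rfl⟩

open Classical in
/-- The points of a polytope at which a linear functional is maximal are spanned by the
generators at which it is maximal. -/
theorem maximizers_eq_convexHull (v : ι → Fin N → ℝ) (l : (Fin N → ℝ) →ₗ[ℝ] ℝ) :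
    {x ∈ convexHull ℝ (Set.range v) | ∀ y ∈ convexHull ℝ (Set.range v), l y ≤ l x} =
      convexHull ℝ (v '' (Finset.univ.filter (fun i => ∀ j, l (v j) ≤ l (v i)) : Finset ι)) := by
  have hr : Set.range v = v '' ((Finset.univ : Finset ι) : Set ι) := by simp
  have key : ∀ (M : ℝ), (∀ j, l (v j) ≤ M) → ∀ y ∈ convexHull ℝ (Set.range v), l y ≤ M := by
    intro M hM y hy
    have : convexHull ℝ (Set.range v) ⊆ {y | l y ≤ M} := by
      apply convexHull_min
      · rintro _ ⟨j, rfl⟩; exact hM j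
      · exact convex_halfSpace_le l.isLinear M
    exact this hy
  ext x
  simp only [Set.mem_ofPred_eq]
  constructor
  · rintro ⟨hx, hmax⟩
    rw [hr, mem_convexHull_image_iff] at hx
    obtain ⟨c, hc, -, hc1, rfl⟩ := hx
    rw [mem_convexHull_image_iff]
    refine ⟨c, hc, fun i hi => ?_, hc1, rfl⟩
    set x := ∑ i, c i • v i with hxdef
    have hle : ∀ j, l (v j) ≤ l x := fun j => hmax _ (subset_convexHull ℝ _ ⟨j, rfl⟩)
    -- Complementary slackness: a vanishing sum of nonnegative terms kills the weight of every
    -- generator at which `l` is not maximal.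
    have hsum : ∑ j, c j * (l x - l (v j)) = 0 := by
      simp only [mul_sub, Finset.sum_sub_distrib]
      rw [← Finset.sum_mul, hc1, hxdef, map_sum]
      simp
    rw [Finset.sum_eq_zero_iff_of_nonneg
      (fun j _ => mul_nonneg (hc j) (sub_nonneg.2 (hle j)))] at hsum
    rcases mul_eq_zero.1 (hsum i (Finset.mem_univ i)) with h | h
    · exact h
    · exact absurd (by simpa using fun j => (hle j).trans (sub_eq_zero.1 h).le) hi
  · intro hx
    refine ⟨convexHull_mono (Set.image_subset_range _ _) hx, ?_⟩
    rw [mem_convexHull_image_iff] at hx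
    obtain ⟨c, hc, hcT, hc1, rfl⟩ := hx
    apply key
    intro j
    have h1 : l (v j) = ∑ i, c i * l (v j) := by rw [← Finset.sum_mul, hc1, one_mul]
    rw [h1, map_sum]
    refine Finset.sum_le_sum fun i _ => ?_
    rw [map_smul, smul_eq_mul]
    by_cases hi : i ∈ Finset.univ.filter (fun i => ∀ j, l (v j) ≤ l (v i))
    · exact mul_le_mul_of_nonneg_left ((Finset.mem_filter.1 hi).2 j) (hc i)
    · simp [hcT i hi]

/-! ### Unimodular simplices: vertices, dimension, normalized volume. -/

/-- Real weights on the points `v i`, `i ∈ T`, with integral total and integral weighted sum are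
integral: the lifts of the points to height one form a basis of a saturated sublattice. -/
def IsUnimodularOn (v : ι → Fin N → ℝ) (T : Finset ι) : Prop :=
  ∀ c : ι → ℝ, (∀ i, i ∉ T → c i = 0) → (∃ n : ℤ, ∑ i, c i = n) →
    (∀ r, ∃ z : ℤ, ∑ i, c i * v i r = z) → ∀ i, ∃ n : ℤ, c i = n

namespace IsUnimodularOn

variable {v : ι → Fin N → ℝ} {T : Finset ι}

/-- An affine dependence stays one after rescaling; scaling a nonzero coefficient to 1/2 would
contradict integrality. Thus unimodularity already contains affine independence. -/
theorem eq_zero (h : IsUnimodularOn v T) {c : ι → ℝ} (hc : ∀ i, i ∉ T → c i = 0)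
    (h0 : ∑ i, c i = 0) (h1 : ∑ i, c i • v i = 0) : c = 0 := by
  funext i
  by_contra hi
  change c i ≠ 0 at hi
  obtain ⟨n, hn⟩ := h (fun j => (2 * c i)⁻¹ * c j) (fun j hj => by simp [hc j hj])
    ⟨0, by rw [← Finset.mul_sum, h0]; simp⟩
    (fun r => ⟨0, by
      have := congrFun h1 r
      simp only [Finset.sum_apply, Pi.smul_apply, smul_eq_mul, Pi.zero_apply] at this
      simp only [mul_assoc]
      rw [← Finset.mul_sum, this]; simp⟩) i
  have h2 : (2 * c i)⁻¹ * c i = 1 / 2 := by field_simp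
  rw [h2] at hn
  have h3 : (1 : ℝ) = ((2 * n : ℤ) : ℝ) := by push_cast; linarith
  have h4 : (1 : ℤ) = 2 * n := by exact_mod_cast h3
  omega

theorem weights_eq (h : IsUnimodularOn v T) {c c' : ι → ℝ} (hc : ∀ i, i ∉ T → c i = 0)
    (hc' : ∀ i, i ∉ T → c' i = 0) (h0 : ∑ i, c i = ∑ i, c' i)
    (h1 : ∑ i, c i • v i = ∑ i, c' i • v i) : c = c' := by
  have := h.eq_zero (c := c - c') (fun i hi => by simp [hc i hi, hc' i hi])
    (by simp [Finset.sum_sub_distrib, h0]) (by simp [sub_smul, Finset.sum_sub_distrib, h1])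
  exact sub_eq_zero.1 this

theorem affineIndependent (h : IsUnimodularOn v T) :
    AffineIndependent ℝ (fun i : T => v i) := by
  classical
  rw [affineIndependent_iff]
  intro s w hw hwv i hi
  let c : ι → ℝ := fun j => if hj : j ∈ T then (if (⟨j, hj⟩ : T) ∈ s then w ⟨j, hj⟩ else 0) else 0
  have hcT : ∀ j : T, c j = if j ∈ s then w j else 0 := fun j => by simp [c]
  have e : ∀ {M : Type} [AddCommMonoid M] (f : ι → M), (∀ j, j ∉ T → f j = 0) →
      ∑ j, f j = ∑ j : T, f j := by
    intro M _ f hf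
    rw [← Finset.sum_subset (Finset.subset_univ T) (fun j _ hj => hf j hj),
      ← Finset.sum_coe_sort T]
  have hc0 : ∀ j, j ∉ T → c j = 0 := fun j hj => by simp [c, hj]
  have hc := h.eq_zero (c := c) hc0 (by rw [e c hc0]; simp [hcT, hw, -Finset.univ_eq_attach])
    (by
      rw [e _ (fun j hj => by simp [hc0 j hj])]
      simp [hcT, ite_smul, hwv, -Finset.univ_eq_attach])
  have := congrFun hc i
  rw [hcT, if_pos hi] at this
  exact this

theorem isSimplex (h : IsUnimodularOn v T) : IsSimplex (convexHull ℝ (v '' (T : Set ι))) := by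
  classical
  refine ⟨T.image v, ?_, by simp⟩
  have := h.affineIndependent.range
  have hr : Set.range (fun i : T => v i) = ((T.image v : Finset _) : Set (Fin N → ℝ)) := by
    ext x; simp
  rw [hr] at this
  exact this

theorem vertices_eq (h : IsUnimodularOn v T) :
    vertices (convexHull ℝ (v '' (T : Set ι))) = v '' (T : Set ι) := by
  classical
  apply Set.Subset.antisymm extremePoints_convexHull_subset
  rintro _ ⟨i, hi, rfl⟩
  refine mem_extremePoints_iff_left.2 ⟨subset_convexHull ℝ _ ⟨i, hi, rfl⟩, ?_⟩
  rintro x hx y hy ⟨a, b, ha, hb, hab, hxy⟩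
  rw [mem_convexHull_image_iff] at hx hy
  obtain ⟨c, hc, hcT, hc1, rfl⟩ := hx
  obtain ⟨c', hc', hcT', hc1', rfl⟩ := hy
  have hw := h.weights_eq (c := fun j => a * c j + b * c' j) (c' := Pi.single i 1)
    (fun j hj => by simp [hcT j hj, hcT' j hj])
    (fun j hj => by
      have : j ≠ i := by rintro rfl; exact hj hi
      simp [this])
    (by rw [Finset.sum_add_distrib, ← Finset.mul_sum, ← Finset.mul_sum, hc1, hc1']; simp [hab])
    (by
      rw [Finset.sum_eq_single (f := fun j => (Pi.single i 1 : ι → ℝ) j • v j) i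
        (by simp +contextual) (by simp)]
      simp only [Pi.single_eq_same, one_smul]
      rw [← hxy]
      simp only [add_smul, mul_smul, Finset.sum_add_distrib, Finset.smul_sum])
  have hz : ∀ j, j ≠ i → c j = 0 := by
    intro j hj
    have := congrFun hw j
    simp only [Pi.single_eq_of_ne hj] at this
    nlinarith [hc j, hc' j, mul_nonneg ha.le (hc j), mul_nonneg hb.le (hc' j)]
  have hi1 : c i = 1 := by
    rw [← hc1, Finset.sum_eq_single i (fun j _ hj => hz j hj) (by simp)]
  rw [Finset.sum_eq_single i (fun j _ hj => by simp [hz j hj]) (by simp), hi1, one_smul]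

theorem dimension_eq (h : IsUnimodularOn v T) {e : ℕ} (he : T.card = e + 1) :
    dimension (convexHull ℝ (v '' (T : Set ι))) = e := by
  have hr : Set.range (fun i : T => v i) = v '' (T : Set ι) := by
    ext x; simp
  have := h.affineIndependent.finrank_vectorSpan (n := e) (by simpa using he)
  rw [hr] at this
  rw [dimension, ← direction_affineSpan, affineSpan_convexHull, direction_affineSpan]
  exact this

/-- The lattice points of the n-th dilate are exactly the combinations of the vertices with natural
weights of total n, each in one way: unimodularity makes the barycentric weights integral, and
affine independence makes them unique. -/
theorem latticeCount_eq (h : IsUnimodularOn v T) (hv : ∀ i r, ∃ z : ℤ, v i r = z)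
    {n : ℕ} (hn : n ≠ 0) :
    latticeCount (convexHull ℝ (v '' (T : Set ι))) n = (T.card + n - 1).choose n := by
  classical
  choose vz hvz using hv
  rw [← Finset.card_finsuppAntidiag_nat_eq_choose, latticeCount, ← Set.ncard_coe_finset]
  symm
  have hcast : ∀ c : ι → ℕ, (fun r => ((∑ i, (c i : ℤ) * vz i r : ℤ) : ℝ)) =
      ∑ i, (c i : ℝ) • v i := by
    intro c
    funext r
    simp [hvz]
  have hsumT : ∀ c : ι →₀ ℕ, c.support ⊆ T → ∑ i, c i = T.sum c := by
    intro c hc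
    refine (Finset.sum_subset (Finset.subset_univ T) fun i _ hi => ?_).symm
    exact Finsupp.notMem_support_iff.1 fun hh => hi (hc hh)
  refine Set.ncard_congr (fun c _ => fun r => ∑ i, (c i : ℤ) * vz i r) ?_ ?_ ?_
  · intro c hc
    rw [Finset.mem_coe, Finset.mem_finsuppAntidiag] at hc
    obtain ⟨hs, hT⟩ := hc
    have h0 : ∀ i, i ∉ T → c i = 0 := fun i hi =>
      Finsupp.notMem_support_iff.1 fun hh => hi (hT hh)
    have hn' : (n : ℝ) ≠ 0 := by exact_mod_cast hn
    rw [Set.mem_ofPred_eq, hcast, Set.mem_smul_set]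
    refine ⟨∑ i, ((n : ℝ)⁻¹ * c i) • v i, ?_, ?_⟩
    · rw [mem_convexHull_image_iff]
      refine ⟨fun i => (n : ℝ)⁻¹ * c i, fun i => by positivity, fun i hi => by simp [h0 i hi],
        ?_, rfl⟩
      rw [← Finset.mul_sum, ← Nat.cast_sum, hsumT c hT, hs]
      exact inv_mul_cancel₀ hn'
    · simp only [mul_smul]
      rw [← Finset.smul_sum, smul_smul, mul_inv_cancel₀ hn', one_smul]
  · intro c c' hc hc' heq
    rw [Finset.mem_coe, Finset.mem_finsuppAntidiag] at hc hc'
    have h0 : ∀ i, i ∉ T → c i = 0 := fun i hi =>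
      Finsupp.notMem_support_iff.1 fun hh => hi (hc.2 hh)
    have h0' : ∀ i, i ∉ T → c' i = 0 := fun i hi =>
      Finsupp.notMem_support_iff.1 fun hh => hi (hc'.2 hh)
    have := h.weights_eq (c := fun i => (c i : ℝ)) (c' := fun i => (c' i : ℝ))
      (fun i hi => by simp [h0 i hi]) (fun i hi => by simp [h0' i hi])
      (by
        rw [← Nat.cast_sum, ← Nat.cast_sum, hsumT c hc.2, hsumT c' hc'.2, hc.1, hc'.1])
      (by
        rw [← hcast, ← hcast]
        funext r
        exact congrArg _ (congrFun heq r))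
    ext i
    exact_mod_cast congrFun this i
  · intro z hz
    rw [Set.mem_ofPred_eq, Set.mem_smul_set] at hz
    obtain ⟨x, hx, hxz⟩ := hz
    rw [mem_convexHull_image_iff] at hx
    obtain ⟨c, hc, hcT, hc1, rfl⟩ := hx
    have hzr : ∀ r, ∑ i, (n * c i) * v i r = z r := by
      intro r
      have := congrFun hxz r
      simp only [Pi.smul_apply, Finset.sum_apply, smul_eq_mul, Finset.mul_sum] at this
      rw [← this]
      exact Finset.sum_congr rfl fun i _ => by ring
    have hint := h (fun i => n * c i) (fun i hi => by simp [hcT i hi])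
      ⟨n, by rw [← Finset.mul_sum, hc1]; simp⟩ (fun r => ⟨z r, hzr r⟩)
    have hnat : ∀ i, ∃ a : ℕ, n * c i = a := by
      intro i
      obtain ⟨a, ha⟩ := hint i
      have h0 : 0 ≤ (a : ℝ) := by rw [← ha]; have := hc i; positivity
      obtain ⟨b, rfl⟩ := Int.eq_ofNat_of_zero_le (by exact_mod_cast h0 : 0 ≤ a)
      exact ⟨b, by simpa using ha⟩
    choose a ha using hnat
    have haT : ∀ i, i ∉ T → a i = 0 := by
      intro i hi
      have := ha i
      rw [hcT i hi, mul_zero] at this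
      exact_mod_cast this.symm
    have hsupp : (Finsupp.equivFunOnFinite.symm a).support ⊆ T := by
      intro i hi
      by_contra hiT
      exact (Finsupp.mem_support_iff.1 hi) (haT i hiT)
    refine ⟨Finsupp.equivFunOnFinite.symm a, ?_, ?_⟩
    · rw [Finset.mem_coe, Finset.mem_finsuppAntidiag]
      refine ⟨?_, hsupp⟩
      rw [← hsumT _ hsupp]
      have : ((∑ i, a i : ℕ) : ℝ) = n := by
        push_cast
        simp only [← ha]
        rw [← Finset.mul_sum, hc1, mul_one]
      exact_mod_cast this
    · funext r
      have := hzr r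
      simp only [ha, hvz] at this
      exact_mod_cast this

/-- The Ehrhart series is ∑ C(e + n, e) λⁿ = (1 - λ)^(-(e+1)), so δ = (1, 0, …, 0). -/
theorem normalizedVolume_eq_one (h : IsUnimodularOn v T) (hv : ∀ i r, ∃ z : ℤ, v i r = z)
    (hT : T.Nonempty) : normalizedVolume (convexHull ℝ (v '' (T : Set ι))) = 1 := by
  obtain ⟨e, he⟩ : ∃ e, T.card = e + 1 := ⟨T.card - 1, by have := hT.card_pos; omega⟩
  have hser : ehrhartSeries (convexHull ℝ (v '' (T : Set ι))) =
      PowerSeries.mk fun n => ((e + n).choose e : ℤ) := by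
    rw [ehrhartSeries]
    congr 1
    funext n
    split_ifs with hn
    · simp [hn]
    · rw [h.latticeCount_eq hv hn, he, show e + 1 + n - 1 = n + e by omega,
        Nat.choose_symm_add, add_comm]
  have hδ : ∀ i, delta (convexHull ℝ (v '' (T : Set ι))) i = if i = 0 then 1 else 0 := by
    intro i
    rw [delta, hser, h.dimension_eq he, mul_comm,
      PowerSeries.mk_add_choose_mul_one_sub_pow_eq_one, PowerSeries.coeff_one]
  rw [normalizedVolume]
  simp [hδ]

end IsUnimodularOn

end LatticePolytope

/-! ### The polytope, its proper faces and their unimodularity. -/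

namespace LatticePolytope

/-- The generators of the stacked polytope: the unit vectors `e_s` in the last `m` coordinates, and
the points `(j, j², …, j²)` on a parabola, `0 ≤ j ≤ k`. -/
def stackedVertex (m k : ℕ) : Fin m ⊕ Fin (k + 1) → Fin (m + 1) → ℝ :=
  Sum.elim (fun s => Pi.single s.succ 1) (fun j => Fin.cons (j : ℝ) fun _ => (j : ℝ) ^ 2)

/-- The index sets of the proper faces of the stacked polytope. -/
def IsFaceIndex {m k : ℕ} (T : Finset (Fin m ⊕ Fin (k + 1))) : Prop :=
  T.toRight = ∅ ∨
  (∃ i, T.toRight = {i} ∧ (T.toLeft = Finset.univ → i = 0 ∨ i = Fin.last k)) ∨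
  (T.toLeft ≠ Finset.univ ∧ ∃ i : Fin k, T.toRight = {i.castSucc, i.succ})

variable {m k : ℕ}

theorem stackedVertex_integral (i : Fin m ⊕ Fin (k + 1)) (r : Fin (m + 1)) :
    ∃ z : ℤ, stackedVertex m k i r = z := by
  rcases i with s | j
  · refine ⟨(Pi.single s.succ 1 : Fin (m + 1) → ℤ) r, ?_⟩
    by_cases h : r = s.succ
    · subst h; simp [stackedVertex]
    · simp [stackedVertex, h]
  · refine Fin.cases ⟨j, by simp [stackedVertex]⟩ (fun s => ⟨(j : ℤ) ^ 2, ?_⟩) r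
    simp [stackedVertex]

theorem stackedVertex_injective (m k : ℕ) : Function.Injective (stackedVertex m k) := by
  rintro (s | j) (s' | j') h
  · have := congrFun h s.succ
    by_cases hs : s = s'
    · rw [hs]
    · simp [stackedVertex, hs] at this
  · have h0 := congrFun h 0
    have h1 := congrFun h s.succ
    simp [stackedVertex] at h0 h1
    rw [← h0] at h1
    norm_num at h1
  · have h0 := congrFun h 0
    have h1 := congrFun h s'.succ
    simp [stackedVertex] at h0 h1
    simp [h0] at h1
  · have h0 := congrFun h 0
    simp only [stackedVertex, Sum.elim_inr, Fin.cons_zero, Nat.cast_inj] at h0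
    rw [Fin.ext h0]

theorem isUnimodularOn_stackedVertex {T : Finset (Fin m ⊕ Fin (k + 1))} (hT : IsFaceIndex T) :
    IsUnimodularOn (stackedVertex m k) T := by
  intro c hc hn hz
  set Z := (Int.castRingHom ℝ).range with hZ
  have memZ : ∀ x : ℝ, (∃ z : ℤ, x = z) ↔ x ∈ Z := by
    intro x
    simp [hZ, RingHom.mem_range, eq_comm]
  simp only [memZ] at hn hz ⊢
  have hnat : ∀ n : ℕ, (n : ℝ) ∈ Z := fun n => natCast_mem Z n
  have hx := hz 0
  have ht := fun s : Fin m => hz s.succ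
  simp only [Fintype.sum_sum_type, stackedVertex, Sum.elim_inl, Sum.elim_inr, Fin.cons_zero,
    Fin.cons_succ, Pi.single_apply, Fin.succ_inj, mul_ite, mul_one, mul_zero,
    Finset.sum_ite_eq, Finset.mem_univ, if_true, (Fin.succ_ne_zero _).symm, if_false,
    Finset.sum_const_zero, zero_add] at hn hx ht
  have hl : ∀ s, s ∉ T.toLeft → c (Sum.inl s) = 0 := fun s hs => hc _ (by simpa using hs)
  have hsum : ∀ f : Fin (k + 1) → ℝ, ∑ j, c (Sum.inr j) * f j =
      ∑ j ∈ T.toRight, c (Sum.inr j) * f j := fun f =>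
    (Finset.sum_subset (Finset.subset_univ _) fun j _ hj => by
      rw [hc _ (by simpa using hj), zero_mul]).symm
  have hr : ∀ j, j ∉ T.toRight → c (Sum.inr j) = 0 := fun j hj => hc _ (by simpa using hj)
  -- Coordinate `s.succ` of the weighted sum is `c (Sum.inl s)` plus the second moment Q of the
  -- parabola weights. So everything reduces to Q being integral: it is 0 for no parabola point, i
  -- times the first moment for one point, and the coordinate of a missing e_s for two.
  have main : ∑ j : Fin (k + 1), c (Sum.inr j) * (j : ℝ) ^ 2 ∈ Z →
      (∀ s, c (Sum.inl s) ∈ Z) ∧ ∑ j, c (Sum.inr j) ∈ Z := by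
    intro hQ
    have h1 : ∀ s, c (Sum.inl s) ∈ Z := fun s => by
      have := sub_mem (ht s) hQ
      rwa [add_sub_cancel_right] at this
    refine ⟨h1, ?_⟩
    have := sub_mem hn (sum_mem fun s (_ : s ∈ Finset.univ) => h1 s)
    rwa [add_sub_cancel_left] at this
  have hS := hsum 1
  simp only [Pi.one_apply, mul_one] at hS
  rw [hsum] at hx
  rw [hsum, hS] at main
  rcases hT with h | ⟨i, h, -⟩ | ⟨hA, i, h⟩
  · simp only [h, Finset.sum_empty] at main
    have := (main (zero_mem _)).1
    rintro (s | j)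
    · exact this s
    · rw [hr j (by simp [h])]; exact zero_mem _
  · simp only [h, Finset.sum_singleton] at main hx
    have := main (by have := mul_mem hx (hnat i); rwa [mul_assoc, ← pow_two] at this)
    rintro (s | j)
    · exact this.1 s
    · by_cases hj : j = i
      · rw [hj]; exact this.2
      · rw [hr j (by simpa [h] using hj)]; exact zero_mem _
  · have hne : i.castSucc ≠ i.succ := (Fin.castSucc_lt_succ).ne
    obtain ⟨s, hs⟩ : ∃ s, s ∉ T.toLeft := by
      by_contra! hh
      exact hA (Finset.eq_univ_iff_forall.2 hh)
    have hQ := ht s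
    rw [hl s hs, zero_add, hsum] at hQ
    obtain ⟨h1, h2⟩ := main hQ
    simp only [h, Finset.sum_pair hne, Fin.val_castSucc, Fin.val_succ] at hx h2
    -- The first moment minus i times the total of the two parabola weights is the weight at i + 1.
    have hb : c (Sum.inr i.succ) ∈ Z := by
      have := sub_mem hx (mul_mem h2 (hnat i))
      push_cast at this
      ring_nf at this
      exact this
    have ha : c (Sum.inr i.castSucc) ∈ Z := by
      have := sub_mem h2 hb
      rwa [add_sub_cancel_right] at this
    rintro (s | j)
    · exact h1 s
    · by_cases hj : j = i.castSucc
      · rw [hj]; exact ha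
      by_cases hj' : j = i.succ
      · rw [hj']; exact hb
      · rw [hr j (by simp [h, hj, hj'])]; exact zero_mem _

/-- The zero sets of the affine functions that are nonnegative on the generators. -/
theorem isFaceIndex_of_nonneg (hk : 1 ≤ k) {T : Finset (Fin m ⊕ Fin (k + 1))}
    {α : Fin m → ℝ} {G D c : ℝ} (hα : ∀ s, 0 ≤ α s)
    (hq : ∀ j : ℕ, j ≤ k → 0 ≤ G * j ^ 2 + D * j + c) (hsum : ∑ s, α s = G + m * c)
    (hl : ∀ s, Sum.inl s ∈ T ↔ α s = 0)
    (hr : ∀ j : Fin (k + 1), Sum.inr j ∈ T ↔ G * (j : ℝ) ^ 2 + D * j + c = 0)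
    (hT : T ≠ Finset.univ) : IsFaceIndex T := by
  have hc : 0 ≤ c := by simpa using hq 0 (by omega)
  by_cases hA : T.toLeft = Finset.univ
  · have hα0 : ∀ s, α s = 0 := fun s => (hl s).1 (by
      rw [← Finset.mem_toLeft, hA]; exact Finset.mem_univ s)
    have hG : G = -(m * c) := by
      simp only [hα0, Finset.sum_const_zero] at hsum; linarith
    have one : ∃ i : Fin (k + 1), (i = 0 ∨ i = Fin.last k) ∧ ∀ j ∈ T.toRight, j = i := by
      rcases hc.eq_or_lt with h0 | h0
      · refine ⟨0, Or.inl rfl, fun j hj => ?_⟩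
        rw [Finset.mem_toRight, hr, hG, ← h0] at hj
        by_contra hj0
        have hj1 : (j : ℝ) ≠ 0 := by
          have : (j : ℕ) ≠ 0 := fun h => hj0 (Fin.ext h)
          exact_mod_cast this
        have hD : D = 0 := by
          have : D * j = 0 := by linarith
          exact (mul_eq_zero.1 this).resolve_right hj1
        apply hT
        rw [Finset.eq_univ_iff_forall]
        rintro (s | i)
        · exact (hl s).2 (hα0 s)
        · rw [hr, hG, ← h0, hD]; simp
      · refine ⟨Fin.last k, Or.inr rfl, fun j hj => ?_⟩
        rw [Finset.mem_toRight, hr] at hj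
        by_contra hjk
        have hlt : (j : ℕ) < k := by
          have : (j : ℕ) ≠ k := fun h => hjk (Fin.ext h)
          have := j.2
          omega
        have hlt' : (0 : ℝ) < (k : ℝ) - j := sub_pos.2 (by exact_mod_cast hlt)
        have hj0 : (0 : ℝ) ≤ j := by positivity
        have hk0 : (0 : ℝ) ≤ k := by positivity
        have hqk := hq k le_rfl
        -- Concavity of q on [0, k] as an identity: with q(0) = c > 0 and q(k) ≥ 0, a zero at j < k
        -- would make the left side positive and the right side nonpositive.
        have e : (k - j : ℝ) * c + j * (G * k ^ 2 + D * k + c)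
            - k * (G * (j : ℝ) ^ 2 + D * j + c) = -(m * c * j * k * (k - j)) := by
          rw [hG]; ring
        rw [hj] at e
        have p1 : 0 < (k - j : ℝ) * c := mul_pos hlt' h0
        have p2 : 0 ≤ (j : ℝ) * (G * k ^ 2 + D * k + c) := mul_nonneg hj0 hqk
        have p3 : 0 ≤ m * c * j * k * (k - j : ℝ) := by positivity
        linarith
    obtain ⟨i, hi, hB⟩ := one
    rcases Finset.subset_singleton_iff.1 (fun j hj => Finset.mem_singleton.2 (hB j hj) :
      T.toRight ⊆ {i}) with h | h
    · exact Or.inl h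
    · exact Or.inr (Or.inl ⟨i, h, fun _ => hi⟩)
  · have hpos : 0 < G + m * c := by
      rw [← hsum]
      obtain ⟨s, hs⟩ : ∃ s, s ∉ T.toLeft := by
        by_contra! hh
        exact hA (Finset.eq_univ_iff_forall.2 hh)
      rw [Finset.mem_toLeft, hl] at hs
      exact Finset.sum_pos' (fun s _ => hα s) ⟨s, Finset.mem_univ s, (hα s).lt_of_ne' hs⟩
    -- Two zeros a < b give q(x) = G (x - a)(x - b). If b ≥ a + 2, then q(a + 1) ≥ 0 forces G ≤ 0,
    -- and c = G a b ≥ 0 forces c = 0, contradicting G + m c > 0.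
    have consec : ∀ a ∈ T.toRight, ∀ b ∈ T.toRight, a < b → (b : ℕ) = a + 1 := by
      intro a ha b hb hab
      rw [Finset.mem_toRight, hr] at ha hb
      by_contra hne
      have hab' : (a : ℕ) + 2 ≤ b := by have : (a : ℕ) < b := hab; omega
      have hab2 : (a : ℝ) + 2 ≤ b := by exact_mod_cast hab'
      have hmid := hq (a + 1) (by have := b.2; omega)
      push_cast at hmid
      have e1 : G * (a + b) + D = 0 := by
        have : (b - a : ℝ) * (G * (a + b) + D) = 0 := by linear_combination hb - ha
        exact (mul_eq_zero.1 this).resolve_left (by linarith)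
      have hG : G ≤ 0 := by
        by_contra! hG
        have e2 : G * (a + 1 : ℝ) ^ 2 + D * (a + 1) + c = -(G * (b - a - 1)) := by
          linear_combination ha + e1
        rw [e2] at hmid
        have : 0 < G * (b - a - 1 : ℝ) := mul_pos hG (by linarith)
        linarith
      have hc0 : c = G * (a * b) := by linear_combination ha - a * e1
      have ha0 : (0 : ℝ) ≤ a * b := by positivity
      have : c = 0 := le_antisymm (hc0.le.trans (mul_nonpos_of_nonpos_of_nonneg hG ha0)) hc
      rw [this] at hpos
      linarith
    rcases T.toRight.eq_empty_or_nonempty with h | h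
    · exact Or.inl h
    · set a := T.toRight.min' h with ha
      have hamem : a ∈ T.toRight := Finset.min'_mem _ _
      by_cases hsing : T.toRight = {a}
      · exact Or.inr (Or.inl ⟨a, hsing, fun hh => absurd hh hA⟩)
      · have hex : ∃ b ∈ T.toRight, b ≠ a := by
          by_contra! hh
          exact hsing (Finset.eq_singleton_iff_unique_mem.2 ⟨hamem, hh⟩)
        obtain ⟨b, hb, hba⟩ := hex
        have hcon : ∀ x ∈ T.toRight, x ≠ a → (x : ℕ) = a + 1 := fun x hx hxa =>
          consec a hamem x hx (lt_of_le_of_ne (Finset.min'_le _ _ hx) hxa.symm)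
        have hb1 := hcon b hb hba
        have hak : (a : ℕ) < k := by have := b.2; omega
        refine Or.inr (Or.inr ⟨hA, ⟨a, hak⟩, ?_⟩)
        have hbs : b = Fin.succ ⟨a, hak⟩ := Fin.ext (by simpa using hb1)
        ext x
        rw [Finset.mem_insert, Finset.mem_singleton, ← hbs]
        have hca : Fin.castSucc (⟨a, hak⟩ : Fin k) = a := rfl
        rw [hca]
        constructor
        · intro hx
          by_cases hxa : x = a
          · exact Or.inl hxa
          · exact Or.inr (Fin.ext ((hcon x hx hxa).trans hb1.symm))
        · rintro (rfl | rfl) <;> assumption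

/-- Supplies, for each face index, a supporting affine function with exactly that zero set; the
relation on ∑ α is what makes the prescribed values come from an affine function. -/
theorem exists_nonneg_of_isFaceIndex (hm : 1 ≤ m) (hk : 1 ≤ k)
    {T : Finset (Fin m ⊕ Fin (k + 1))} (hT : IsFaceIndex T) :
    ∃ (α : Fin m → ℝ) (G D c : ℝ), (∀ s, 0 ≤ α s) ∧
      (∀ j : Fin (k + 1), 0 ≤ G * (j : ℝ) ^ 2 + D * j + c) ∧ ∑ s, α s = G + m * c ∧
      (∀ s, Sum.inl s ∈ T ↔ α s = 0) ∧
      (∀ j : Fin (k + 1), Sum.inr j ∈ T ↔ G * (j : ℝ) ^ 2 + D * j + c = 0) := by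
  classical
  by_cases hA : T.toLeft = Finset.univ
  · have hl : ∀ s, Sum.inl s ∈ T ↔ (0 : ℝ) = 0 := fun s => by
      rw [← Finset.mem_toLeft, hA]; simp
    -- With α = 0 the relation reads G = -m c; taking c = k gives a quadratic vanishing only at j =
    -- k. The function j vanishes only at 0, and the sum of the two vanishes nowhere on the parabola
    -- points.
    have fac : ∀ j : Fin (k + 1), (-(m * k) : ℝ) * (j : ℝ) ^ 2 + (m * k ^ 2 - 1) * j + k =
        (k - j) * (1 + m * k * j) := fun j => by ring
    have hjk : ∀ j : Fin (k + 1), (0 : ℝ) ≤ k - j := fun j =>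
      sub_nonneg.2 (by exact_mod_cast Nat.lt_succ_iff.1 j.2)
    have hp : ∀ j : Fin (k + 1), (0 : ℝ) < 1 + m * k * j := fun j => by positivity
    have hlast : ∀ j : Fin (k + 1), ((k : ℝ) - j) * (1 + m * k * j) = 0 ↔ j = Fin.last k := by
      intro j
      rw [mul_eq_zero, or_iff_left (hp j).ne', sub_eq_zero, Nat.cast_inj, Fin.ext_iff, eq_comm,
        Fin.val_last]
    have hzero : ∀ j : Fin (k + 1), (j : ℝ) = 0 ↔ j = 0 := by
      intro j
      rw [Nat.cast_eq_zero, Fin.ext_iff, Fin.val_zero]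
    have hB : T.toRight = ∅ ∨ T.toRight = {0} ∨ T.toRight = {Fin.last k} := by
      rcases hT with h | ⟨i, h, hi⟩ | ⟨h, -⟩
      · exact Or.inl h
      · rcases hi hA with rfl | rfl
        · exact Or.inr (Or.inl h)
        · exact Or.inr (Or.inr h)
      · exact absurd hA h
    rcases hB with h | h | h
    · refine ⟨0, -(m * k), m * k ^ 2 - 1 + 1, k, fun _ => le_rfl, fun j => ?_, by simp, hl,
        fun j => ?_⟩
      · rw [add_mul, ← add_assoc, add_right_comm, fac]
        have := mul_nonneg (hjk j) (hp j).le
        positivity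
      · have h1 := mul_nonneg (hjk j) (hp j).le
        have h2 : (0 : ℝ) ≤ j := by positivity
        rw [add_mul, ← add_assoc, add_right_comm, fac, one_mul, add_eq_zero_iff_of_nonneg h1 h2,
          hlast, hzero, ← Finset.mem_toRight, h]
        simp only [Finset.notMem_empty, false_iff, not_and]
        rintro rfl h0
        have : (k : ℕ) = 0 := by simpa using congrArg Fin.val h0
        omega
    · refine ⟨0, 0, 1, 0, fun _ => le_rfl, fun j => ?_, by simp, hl, fun j => ?_⟩
      · simp
      · rw [← Finset.mem_toRight, h, Finset.mem_singleton, ← hzero]; simp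
    · refine ⟨0, -(m * k), m * k ^ 2 - 1, k, fun _ => le_rfl, fun j => ?_, by simp, hl,
        fun j => ?_⟩
      · rw [fac]; exact mul_nonneg (hjk j) (hp j).le
      · rw [← Finset.mem_toRight, h, Finset.mem_singleton, fac, hlast]
  · have hcard : 0 < (T.toLeft)ᶜ.card := by
      rw [Finset.card_pos, Finset.nonempty_iff_ne_empty]
      simpa [Finset.compl_eq_empty_iff] using hA
    -- With some e_s off the face, any admissible q with G + m c > 0 will do: this total is shared
    -- equally among the missing e_s. The choices of q below are 1, (j - i)² and (j - i)(j - i - 1).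
    have build : ∀ G D c : ℝ, 0 < G + m * c →
        (∀ j : Fin (k + 1), 0 ≤ G * (j : ℝ) ^ 2 + D * j + c) →
        (∀ j : Fin (k + 1), j ∈ T.toRight ↔ G * (j : ℝ) ^ 2 + D * j + c = 0) →
        ∃ (α : Fin m → ℝ) (G D c : ℝ), (∀ s, 0 ≤ α s) ∧
          (∀ j : Fin (k + 1), 0 ≤ G * (j : ℝ) ^ 2 + D * j + c) ∧ ∑ s, α s = G + m * c ∧
          (∀ s, Sum.inl s ∈ T ↔ α s = 0) ∧
          (∀ j : Fin (k + 1), Sum.inr j ∈ T ↔ G * (j : ℝ) ^ 2 + D * j + c = 0) := by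
      intro G D c hpos hq hr
      have hcard' : (0 : ℝ) < (T.toLeft)ᶜ.card := by exact_mod_cast hcard
      refine ⟨fun s => if s ∈ T.toLeft then 0 else (G + m * c) / (T.toLeft)ᶜ.card, G, D, c,
        fun s => ?_, hq, ?_, fun s => ?_, fun j => ?_⟩
      · dsimp only
        split_ifs
        · exact le_rfl
        · positivity
      · have : ∀ s, (if s ∈ T.toLeft then (0 : ℝ) else (G + m * c) / (T.toLeft)ᶜ.card) =
            if s ∈ (T.toLeft)ᶜ then (G + m * c) / (T.toLeft)ᶜ.card else 0 := by
          intro s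
          by_cases hs : Sum.inl s ∈ T <;> simp [hs]
        simp only [this]
        rw [Finset.sum_ite_mem, Finset.univ_inter, Finset.sum_const, nsmul_eq_mul]
        field_simp
      · rw [← Finset.mem_toLeft]
        by_cases hs : s ∈ T.toLeft
        · simp [hs]
        · simp only [hs, if_false, false_iff]
          positivity
      · rw [← Finset.mem_toRight, hr]
    have hm' : (1 : ℝ) ≤ m := by exact_mod_cast hm
    rcases hT with h | ⟨i, h, -⟩ | ⟨-, i, h⟩
    · refine build 0 0 1 (by positivity) (fun j => by simp) (fun j => by simp [h])
    · refine build 1 (-(2 * i)) (i ^ 2) (by positivity) (fun j => ?_) (fun j => ?_)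
      · have : (1 : ℝ) * (j : ℝ) ^ 2 + -(2 * i) * j + i ^ 2 = (j - i) ^ 2 := by ring
        rw [this]; positivity
      · have : (1 : ℝ) * (j : ℝ) ^ 2 + -(2 * i) * j + i ^ 2 = (j - i) ^ 2 := by ring
        rw [this, h, Finset.mem_singleton, sq_eq_zero_iff, sub_eq_zero, Nat.cast_inj,
          Fin.ext_iff]
    · have fac : ∀ j : Fin (k + 1), (1 : ℝ) * (j : ℝ) ^ 2 + -(2 * i + 1) * j + i * (i + 1) =
          (j - i) * (j - (i + 1)) := fun j => by ring
      refine build 1 (-(2 * i + 1)) (i * (i + 1)) (by positivity) (fun j => ?_) (fun j => ?_)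
      · rw [fac]
        rcases Nat.lt_or_ge i j with hij | hij
        · have : ((i : ℕ) : ℝ) + 1 ≤ j := by exact_mod_cast hij
          exact mul_nonneg (by linarith) (by linarith)
        · have : (j : ℝ) ≤ (i : ℕ) := by exact_mod_cast hij
          exact mul_nonneg_of_nonpos_of_nonpos (by linarith) (by linarith)
      · rw [fac, h, Finset.mem_insert, Finset.mem_singleton, mul_eq_zero, sub_eq_zero,
          sub_eq_zero, Fin.ext_iff, Fin.ext_iff, Fin.val_castSucc, Fin.val_succ]
        norm_cast

/-- The stacked polytope. -/
def stackedPolytope (m k : ℕ) : Set (Fin (m + 1) → ℝ) :=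
  convexHull ℝ (Set.range (stackedVertex m k))

theorem sum_mul_stackedVertex_inr (l : Fin (m + 1) → ℝ) (j : Fin (k + 1)) :
    ∑ r, l r * stackedVertex m k (Sum.inr j) r =
      l 0 * j + (∑ s : Fin m, l s.succ) * (j : ℝ) ^ 2 := by
  rw [Fin.sum_univ_succ, Finset.sum_mul]
  simp [stackedVertex]

theorem isProperFace_stackedPolytope_iff (hm : 1 ≤ m) (hk : 1 ≤ k)
    {F : Set (Fin (m + 1) → ℝ)} : IsProperFace (stackedPolytope m k) F ↔
      ∃ T : Finset (Fin m ⊕ Fin (k + 1)), IsFaceIndex T ∧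
        F = convexHull ℝ (stackedVertex m k '' (T : Set (Fin m ⊕ Fin (k + 1)))) := by
  classical
  have happly : ∀ (l : (Fin (m + 1) → ℝ) →ₗ[ℝ] ℝ) (x : Fin (m + 1) → ℝ),
      l x = ∑ r, l (Pi.single r 1) * x r := by
    intro l x
    conv_lhs => rw [← Finset.univ_sum_single x, map_sum]
    refine Finset.sum_congr rfl fun r _ => ?_
    rw [mul_comm, ← smul_eq_mul, ← map_smul, ← Pi.single_smul, smul_eq_mul, mul_one]
  constructor
  · rintro ⟨hexp, hne⟩
    rcases F.eq_empty_or_nonempty with rfl | hF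
    · exact ⟨∅, Or.inl rfl, by simp⟩
    obtain ⟨l, hl⟩ := hexp hF
    have hmax := maximizers_eq_convexHull (stackedVertex m k) l.toLinearMap
    set T : Finset (Fin m ⊕ Fin (k + 1)) := Finset.univ.filter (fun i => ∀ j,
      l.toLinearMap (stackedVertex m k j) ≤ l.toLinearMap (stackedVertex m k i)) with hTdef
    have hFT : F = convexHull ℝ (stackedVertex m k '' (T : Set (Fin m ⊕ Fin (k + 1)))) := by
      rw [hl, ← hmax]; rfl
    refine ⟨T, ?_, hFT⟩
    have hTu : T ≠ Finset.univ := by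
      intro h
      apply hne
      rw [hFT, h, stackedPolytope]
      simp
    obtain ⟨i₀, hi₀⟩ : T.Nonempty := by
      rw [Finset.nonempty_iff_ne_empty]
      intro h
      rw [hFT, h] at hF
      simp at hF
    rw [hTdef, Finset.mem_filter] at hi₀
    set f := l.toLinearMap with hf
    set M := f (stackedVertex m k i₀) with hM
    have hTM : ∀ i, i ∈ T ↔ M - f (stackedVertex m k i) = 0 := by
      intro i
      rw [hTdef, Finset.mem_filter, sub_eq_zero]
      constructor
      · rintro ⟨-, h⟩
        exact le_antisymm (h i₀) (hi₀.2 i)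
      · intro h
        exact ⟨Finset.mem_univ _, fun j => (hi₀.2 j).trans h.le⟩
    -- The slack M - f restricted to the parabola; its constant term is M because the point j = 0 is
    -- the origin.
    have hqv : ∀ j : Fin (k + 1), (-∑ s : Fin m, f (Pi.single s.succ 1)) * (j : ℝ) ^ 2 +
        (-f (Pi.single 0 1)) * j + M = M - f (stackedVertex m k (Sum.inr j)) := by
      intro j
      rw [happly f (stackedVertex m k (Sum.inr j)),
        sum_mul_stackedVertex_inr (fun r => f (Pi.single r 1))]
      ring
    refine isFaceIndex_of_nonneg hk (α := fun s => M - f (stackedVertex m k (Sum.inl s)))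
      (G := -∑ s : Fin m, f (Pi.single s.succ 1)) (D := -f (Pi.single 0 1)) (c := M)
      (fun s => sub_nonneg.2 (hi₀.2 _)) (fun j hj => ?_) ?_ (fun s => hTM _) (fun j => ?_) hTu
    · have := hqv ⟨j, Nat.lt_succ_of_le hj⟩
      simp only at this
      rw [this]
      exact sub_nonneg.2 (hi₀.2 _)
    · rw [Finset.sum_sub_distrib]
      simp [stackedVertex]
      ring
    · rw [hTM, hqv]
  · rintro ⟨T, hT, rfl⟩
    rcases T.eq_empty_or_nonempty with rfl | hTne
    · refine ⟨?_, ?_⟩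
      · simp only [Finset.coe_empty, Set.image_empty, convexHull_empty]
        exact isExposed_empty
      · simp only [Finset.coe_empty, Set.image_empty, convexHull_empty]
        refine (Set.Nonempty.ne_empty ?_).symm
        exact ⟨_, subset_convexHull ℝ _ ⟨Sum.inr 0, rfl⟩⟩
    obtain ⟨α, G, D, c, hα, hq, hsum, hl, hr⟩ := exists_nonneg_of_isFaceIndex hm hk hT
    -- Chosen so that c - f takes the values α_s and q(j) on the generators; the coefficient of j²
    -- comes out as G by the relation on ∑ α.
    set a : Fin (m + 1) → ℝ := Fin.cons (-D) fun s => c - α s with ha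
    let f : (Fin (m + 1) → ℝ) →ₗ[ℝ] ℝ := ∑ r, a r • LinearMap.proj r
    have hf : ∀ x, f x = ∑ r, a r * x r := fun x => by simp [f]
    have hval : ∀ i, 0 ≤ c - f (stackedVertex m k i) ∧
        (i ∈ T ↔ c - f (stackedVertex m k i) = 0) := by
      rintro (s | j)
      · have : c - f (stackedVertex m k (Sum.inl s)) = α s := by
          rw [hf]; simp [stackedVertex, Pi.single_apply, ha]
        rw [this]
        exact ⟨hα s, hl s⟩
      · have : c - f (stackedVertex m k (Sum.inr j)) = G * (j : ℝ) ^ 2 + D * j + c := by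
          rw [hf, sum_mul_stackedVertex_inr]
          simp only [ha, Fin.cons_zero, Fin.cons_succ, Finset.sum_sub_distrib, hsum]
          simp
          ring
        rw [this]
        exact ⟨hq j, hr j⟩
    have hfil : (Finset.univ.filter (fun i => ∀ j, f (stackedVertex m k j) ≤
        f (stackedVertex m k i))) = T := by
      ext i
      rw [Finset.mem_filter]
      constructor
      · rintro ⟨-, h⟩
        obtain ⟨i₀, hi₀⟩ := hTne
        have h1 := (hval i₀).2.1 hi₀
        have h2 := (hval i).1
        have h3 := h i₀
        exact (hval i).2.2 (by linarith)
      · intro h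
        refine ⟨Finset.mem_univ _, fun j => ?_⟩
        have h1 := (hval i).2.1 h
        have h2 := (hval j).1
        linarith
    have hmax := maximizers_eq_convexHull (stackedVertex m k) f
    rw [hfil] at hmax
    refine ⟨fun _ => ⟨LinearMap.toContinuousLinearMap f, hmax.symm⟩, fun heq => ?_⟩
    have hall : ∀ i, i ∈ T := by
      intro i
      rw [← hfil, Finset.mem_filter]
      refine ⟨Finset.mem_univ _, fun j => ?_⟩
      have hi : stackedVertex m k i ∈
          convexHull ℝ (stackedVertex m k '' (T : Set (Fin m ⊕ Fin (k + 1)))) := by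
        rw [heq]
        exact subset_convexHull ℝ _ ⟨i, rfl⟩
      rw [← hmax] at hi
      exact hi.2 _ (subset_convexHull ℝ _ ⟨j, rfl⟩)
    have hlast : (0 : Fin (k + 1)) ≠ Fin.last k := by
      intro h
      have : 0 = k := by simpa using congrArg Fin.val h
      omega
    have hB : ∀ j, j ∈ T.toRight := fun j => Finset.mem_toRight.2 (hall _)
    rcases hT with h | ⟨i, h, -⟩ | ⟨h, -⟩
    · have := hB 0
      simp [h] at this
    · have h0 := hB 0
      have h1 := hB (Fin.last k)
      rw [h, Finset.mem_singleton] at h0 h1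
      exact hlast (h0.trans h1.symm)
    · exact h (Finset.eq_univ_iff_forall.2 fun s => Finset.mem_toLeft.2 (hall _))

theorem isPolytope_stackedPolytope : IsPolytope (stackedPolytope m k) := by
  classical
  exact ⟨Finset.univ.image (stackedVertex m k), by simp [stackedPolytope]⟩

theorem isIntegralPolytope_stackedPolytope : IsIntegralPolytope (stackedPolytope m k) := by
  refine ⟨isPolytope_stackedPolytope, fun v hv => ?_⟩
  obtain ⟨i, rfl⟩ := extremePoints_convexHull_subset hv
  choose z hz using stackedVertex_integral (m := m) (k := k) i
  exact ⟨z, funext hz⟩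

theorem isSimplicialPolytope_stackedPolytope (hm : 1 ≤ m) (hk : 1 ≤ k) :
    IsSimplicialPolytope (stackedPolytope m k) := by
  refine ⟨isPolytope_stackedPolytope, fun F hF => ?_⟩
  obtain ⟨T, hT, rfl⟩ := (isProperFace_stackedPolytope_iff hm hk).1 hF
  exact (isUnimodularOn_stackedVertex hT).isSimplex

theorem dimension_stackedPolytope (hk : 1 ≤ k) : dimension (stackedPolytope m k) = m + 1 := by
  have htop : vectorSpan ℝ (stackedPolytope m k) = ⊤ := by
    have hmem : ∀ i, stackedVertex m k i ∈ vectorSpan ℝ (stackedPolytope m k) := by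
      intro i
      have h0 : stackedVertex m k (Sum.inr 0) = 0 := by
        funext r
        refine Fin.cases ?_ (fun s => ?_) r <;> simp [stackedVertex]
      have := vsub_mem_vectorSpan ℝ
        (subset_convexHull ℝ (Set.range (stackedVertex m k)) ⟨i, rfl⟩)
        (subset_convexHull ℝ (Set.range (stackedVertex m k)) ⟨Sum.inr 0, rfl⟩)
      rwa [h0, vsub_eq_sub, sub_zero] at this
    have hs : ∀ s : Fin m, (Pi.single s.succ 1 : Fin (m + 1) → ℝ) ∈
        vectorSpan ℝ (stackedPolytope m k) := fun s => hmem (Sum.inl s)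
    have h0 : (Pi.single 0 1 : Fin (m + 1) → ℝ) ∈ vectorSpan ℝ (stackedPolytope m k) := by
      -- The parabola point j = 1 is (1, …, 1), so subtracting all the e_s leaves the first unit
      -- vector.
      have h1 := sub_mem (hmem (Sum.inr ⟨1, by omega⟩))
        (sum_mem fun s (_ : s ∈ (Finset.univ : Finset (Fin m))) => hs s)
      convert h1 using 1
      funext r
      refine Fin.cases ?_ (fun s => ?_) r
      · simp [stackedVertex]
      · simp [stackedVertex, Pi.single_apply]
    rw [eq_top_iff]
    intro x _
    rw [← Finset.univ_sum_single x]
    refine sum_mem fun r _ => ?_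
    have : (Pi.single r (x r) : Fin (m + 1) → ℝ) = x r • Pi.single r 1 := by
      rw [← Pi.single_smul, smul_eq_mul, mul_one]
    rw [this]
    exact Submodule.smul_mem _ _ (Fin.cases h0 hs r)
  rw [dimension, htop, finrank_top]
  simp

theorem normalizedVolume_facet_stackedPolytope (hm : 1 ≤ m) (hk : 1 ≤ k)
    {F : Set (Fin (m + 1) → ℝ)} (hF : IsFacet (stackedPolytope m k) F) :
    normalizedVolume F = 1 := by
  obtain ⟨hp, hne, -⟩ := hF
  obtain ⟨T, hT, rfl⟩ := (isProperFace_stackedPolytope_iff hm hk).1 hp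
  refine (isUnimodularOn_stackedVertex hT).normalizedVolume_eq_one stackedVertex_integral ?_
  rw [Finset.nonempty_iff_ne_empty]
  rintro rfl
  simp at hne

theorem boundaryComplex_stackedPolytope (hm : 1 ≤ m) (hk : 1 ≤ k) :
    boundaryComplex (stackedPolytope m k) =
      (fun T : Finset (Fin m ⊕ Fin (k + 1)) =>
        T.map ⟨stackedVertex m k, stackedVertex_injective m k⟩) '' {T | IsFaceIndex T} := by
  ext W
  constructor
  · rintro ⟨F, hF, hW⟩
    obtain ⟨T, hT, rfl⟩ := (isProperFace_stackedPolytope_iff hm hk).1 hF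
    refine ⟨T, hT, ?_⟩
    rw [(isUnimodularOn_stackedVertex hT).vertices_eq] at hW
    rw [← Finset.coe_inj, hW]
    simp
  · rintro ⟨T, hT, rfl⟩
    refine ⟨_, (isProperFace_stackedPolytope_iff hm hk).2 ⟨T, hT, rfl⟩, ?_⟩
    rw [(isUnimodularOn_stackedVertex hT).vertices_eq]
    simp

end LatticePolytope

/-! ### Face numbers. -/

namespace LatticePolytope

variable {m k : ℕ}

/-- Splits faces by their number of parabola points. For two points the condition that some e_s be
missing can be dropped, since all m of them would give m + 2 > j elements. -/
theorem isFaceIndex_card_iff {j : ℕ} (hj : j ≤ m + 1) (T : Finset (Fin m ⊕ Fin (k + 1))) :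
    (IsFaceIndex T ∧ T.card = j) ↔
      ((∃ A : Finset (Fin m), A.card = j ∧ A.disjSum ∅ = T) ∨
      (∃ (A : Finset (Fin m)) (i : Fin (k + 1)), A.card + 1 = j ∧
        (A = Finset.univ → i = 0 ∨ i = Fin.last k) ∧ A.disjSum {i} = T)) ∨
      (∃ (A : Finset (Fin m)) (i : Fin k), A.card + 2 = j ∧
        A.disjSum {i.castSucc, i.succ} = T) := by
  have hne : ∀ i : Fin k, i.castSucc ≠ i.succ := fun i => Fin.castSucc_lt_succ.ne
  constructor
  · rintro ⟨hT, rfl⟩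
    rw [← Finset.card_toLeft_add_card_toRight]
    rcases hT with h | ⟨i, h, hi⟩ | ⟨-, i, h⟩
    · exact Or.inl (Or.inl ⟨T.toLeft, by simp [h], by rw [← h, Finset.toLeft_disjSum_toRight]⟩)
    · exact Or.inl (Or.inr ⟨T.toLeft, i, by simp [h], hi,
        by rw [← h, Finset.toLeft_disjSum_toRight]⟩)
    · exact Or.inr ⟨T.toLeft, i, by rw [h, Finset.card_pair (hne i)],
        by rw [← h, Finset.toLeft_disjSum_toRight]⟩
  · rintro ((⟨A, hA, rfl⟩ | ⟨A, i, hA, hi, rfl⟩) | ⟨A, i, hA, rfl⟩)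
    · exact ⟨Or.inl Finset.toRight_disjSum, by simpa using hA⟩
    · exact ⟨Or.inr (Or.inl ⟨i, by simp, by simpa using hi⟩), by simpa using hA⟩
    · refine ⟨Or.inr (Or.inr ⟨?_, i, by simp⟩), ?_⟩
      · rw [Finset.toLeft_disjSum]
        rintro rfl
        rw [Finset.card_univ, Fintype.card_fin] at hA
        omega
      · rw [Finset.card_disjSum, Finset.card_pair (hne i), hA]

-- The correction term counts the k - 1 interior parabola points that cannot be joined to all of the
-- e_s; it matters only for j = m + 1.
open Classical in
theorem ncard_isFaceIndex (hk : 1 ≤ k) {j : ℕ} (hj : j ≤ m + 1) :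
    (Set.ncard {T : Finset (Fin m ⊕ Fin (k + 1)) | IsFaceIndex T ∧ T.card = j} : ℤ) =
      (Finset.univ.filter fun A : Finset (Fin m) => A.card = j).card +
      (k + 1) * (Finset.univ.filter fun A : Finset (Fin m) => A.card + 1 = j).card +
      k * (Finset.univ.filter fun A : Finset (Fin m) => A.card + 2 = j).card -
      (if j = m + 1 then (k : ℤ) - 1 else 0) := by
  set S0 := Finset.univ.filter fun A : Finset (Fin m) => A.card = j
  set S1 := Finset.univ.filter fun p : Finset (Fin m) × Fin (k + 1) =>
    p.1.card + 1 = j ∧ (p.1 = Finset.univ → p.2 = 0 ∨ p.2 = Fin.last k) with hS1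
  set S2 := (Finset.univ.filter fun A : Finset (Fin m) => A.card + 2 = j) ×ˢ
    (Finset.univ : Finset (Fin k))
  set E0 : Finset (Finset (Fin m ⊕ Fin (k + 1))) := S0.image fun A => A.disjSum ∅ with hE0
  set E1 : Finset (Finset (Fin m ⊕ Fin (k + 1))) := S1.image fun p => p.1.disjSum {p.2} with hE1
  set E2 : Finset (Finset (Fin m ⊕ Fin (k + 1))) :=
    S2.image fun p => p.1.disjSum {p.2.castSucc, p.2.succ} with hE2
  have hne : ∀ i : Fin k, i.castSucc ≠ i.succ := fun i => Fin.castSucc_lt_succ.ne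
  have hset : {T : Finset (Fin m ⊕ Fin (k + 1)) | IsFaceIndex T ∧ T.card = j} =
      ((E0 ∪ E1 ∪ E2 : Finset _) : Set (Finset (Fin m ⊕ Fin (k + 1)))) := by
    ext T
    rw [Set.mem_ofPred_eq, isFaceIndex_card_iff hj]
    simp [hE0, hE1, hE2, S0, S1, S2, and_assoc, or_assoc]
  have c0 : ∀ T ∈ E0, T.toRight.card = 0 := by
    intro T hT
    obtain ⟨A, -, rfl⟩ := Finset.mem_image.1 hT
    rw [Finset.toRight_disjSum, Finset.card_empty]
  have c1 : ∀ T ∈ E1, T.toRight.card = 1 := by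
    intro T hT
    obtain ⟨A, -, rfl⟩ := Finset.mem_image.1 hT
    simp
  have c2 : ∀ T ∈ E2, T.toRight.card = 2 := by
    intro T hT
    obtain ⟨A, -, rfl⟩ := Finset.mem_image.1 hT
    simp [hne]
  have d01 : Disjoint E0 E1 := by
    rw [Finset.disjoint_left]
    intro T h h'
    have := c0 T h; have := c1 T h'; omega
  have d012 : Disjoint (E0 ∪ E1) E2 := by
    rw [Finset.disjoint_left]
    intro T h h'
    have h2 := c2 T h'
    rcases Finset.mem_union.1 h with h | h
    · have := c0 T h; omega
    · have := c1 T h; omega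
  have i0 : E0.card = S0.card := Finset.card_image_of_injective _ fun A B h => by simpa using h
  have i1 : E1.card = S1.card := Finset.card_image_of_injective _ fun A B h => by
    have := Finset.disjSum_inj.1 h
    exact Prod.ext this.1 (Finset.singleton_inj.1 this.2)
  have i2 : E2.card = S2.card := Finset.card_image_of_injective _ fun A B h => by
    have h2 := Finset.disjSum_inj.1 h
    refine Prod.ext h2.1 (Fin.ext ?_)
    -- A pair {i, i + 1} determines i: each lower end lies in the other pair.
    have ha : A.2.castSucc ∈ ({B.2.castSucc, B.2.succ} : Finset (Fin (k + 1))) := by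
      rw [← h2.2]; simp
    have hb : B.2.castSucc ∈ ({A.2.castSucc, A.2.succ} : Finset (Fin (k + 1))) := by
      rw [h2.2]; simp
    simp only [Finset.mem_insert, Finset.mem_singleton, Fin.ext_iff, Fin.val_castSucc,
      Fin.val_succ] at ha hb
    omega
  rw [hset, Set.ncard_coe_finset, Finset.card_union_of_disjoint d012,
    Finset.card_union_of_disjoint d01, i0, i1, i2]
  have s2 : S2.card = (Finset.univ.filter fun A : Finset (Fin m) => A.card + 2 = j).card * k := by
    simp [S2]
  have s1 : (S1.card : ℤ) =
      (k + 1) * (Finset.univ.filter fun A : Finset (Fin m) => A.card + 1 = j).card -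
        (if j = m + 1 then (k : ℤ) - 1 else 0) := by
    split_ifs with hjm
    · have hu : ∀ A : Finset (Fin m), A.card + 1 = j ↔ A = Finset.univ := by
        intro A
        rw [hjm, Nat.add_right_cancel_iff, ← Finset.card_eq_iff_eq_univ A, Fintype.card_fin]
      have e1 : S1 = ({Finset.univ} : Finset (Finset (Fin m))) ×ˢ {0, Fin.last k} := by
        ext ⟨A, i⟩
        simp only [hS1, hu, Finset.mem_filter, Finset.mem_univ, true_and, Finset.mem_product,
          Finset.mem_singleton, Finset.mem_insert]
        tauto
      have hl : (0 : Fin (k + 1)) ≠ Fin.last k := by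
        intro h
        have : 0 = k := by simpa using congrArg Fin.val h
        omega
      have e2 : (Finset.univ.filter fun A : Finset (Fin m) => A.card + 1 = j) =
          {Finset.univ} := by
        ext A; simp [hu]
      rw [e1, e2, Finset.card_product, Finset.card_pair hl]
      simp
    · have e1 : S1 = (Finset.univ.filter fun A : Finset (Fin m) => A.card + 1 = j) ×ˢ
          Finset.univ := by
        ext ⟨A, i⟩
        simp only [hS1, Finset.mem_filter, Finset.mem_univ, true_and, Finset.mem_product,
          and_true, and_iff_left_iff_imp]
        rintro hA rfl
        rw [Finset.card_univ, Fintype.card_fin] at hA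
        omega
      rw [e1, Finset.card_product]
      simp
      ring
  push_cast
  rw [s1, s2]
  push_cast
  ring

theorem card_filter_card_add (a j : ℕ) :
    (Finset.univ.filter fun A : Finset (Fin m) => A.card + a = j).card =
      if a ≤ j then m.choose (j - a) else 0 := by
  split_ifs with h
  · have : (Finset.univ.filter fun A : Finset (Fin m) => A.card + a = j) =
        Finset.powersetCard (j - a) Finset.univ := by
      ext A
      simp only [Finset.mem_filter, Finset.mem_univ, true_and, Finset.mem_powersetCard,
        Finset.subset_univ]
      omega
    rw [this, Finset.card_powersetCard, Finset.card_univ, Fintype.card_fin]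
  · rw [Finset.card_eq_zero, Finset.filter_eq_empty_iff]
    intro A _
    omega

/-- Pascal's rule merges C(m, j) + (k+1) C(m, j-1) + k C(m, j-2) into binomials of m + 1, the form
suited to the h-transform. -/
theorem faceCount_stackedPolytope (hm : 1 ≤ m) (hk : 1 ≤ k) {j : ℕ} (hj : j ≤ m + 1) :
    (faceCount (boundaryComplex (stackedPolytope m k)) j : ℤ) =
      (m + 1).choose j + k * (if j = 0 then 0 else ((m + 1).choose (j - 1) : ℤ)) -
        (k - 1) * (if j = m + 1 then 1 else 0) := by
  have himg : {W | W ∈ boundaryComplex (stackedPolytope m k) ∧ W.card = j} =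
      (fun T : Finset (Fin m ⊕ Fin (k + 1)) =>
        T.map ⟨stackedVertex m k, stackedVertex_injective m k⟩) ''
        {T | IsFaceIndex T ∧ T.card = j} := by
    rw [boundaryComplex_stackedPolytope hm hk]
    ext W
    constructor
    · rintro ⟨⟨T, hT, rfl⟩, hc⟩
      exact ⟨T, ⟨hT, by simpa using hc⟩, rfl⟩
    · rintro ⟨T, ⟨hT, hc⟩, rfl⟩
      exact ⟨⟨T, hT, rfl⟩, by simpa using hc⟩
  rw [faceCount, himg, Set.ncard_image_of_injective _ (Finset.map_injective _),
    ncard_isFaceIndex hk hj]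
  have h0 := card_filter_card_add (m := m) 0 j
  simp only [add_zero, Nat.zero_le, if_true, Nat.sub_zero] at h0
  rw [h0, card_filter_card_add, card_filter_card_add]
  rcases j with _ | _ | j
  · simp
  · simp
    ring
  · have h1 := Nat.choose_succ_succ' m (j + 1)
    have h2 := Nat.choose_succ_succ' m j
    simp only [show j + 1 + 1 - 1 = j + 1 by omega, show j + 1 + 1 - 2 = j by omega]
    rw [h1, h2]
    simp
    ring

/-! ### Binomial identities and the h-vector. -/

/-- The coefficient form of ∑ C(d, j) (x-1)^(d-j) = x^d. Since C(d, j) C(d-j, i-j) = C(d, i) C(i,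
j), it reduces to an alternating row sum. -/
theorem alternating_sum_choose_mul_choose {d i : ℕ} (hi : i ≤ d) :
    ∑ j ∈ Finset.range (i + 1), (-1 : ℤ) ^ (i - j) * ((d - j).choose (i - j) : ℤ) * d.choose j =
      if i = 0 then 1 else 0 := by
  have h : ∀ j ∈ Finset.range (i + 1),
      (-1 : ℤ) ^ (i - j) * ((d - j).choose (i - j) : ℤ) * d.choose j =
        (-1) ^ i * d.choose i * ((-1) ^ j * i.choose j) := by
    intro j hj
    have hji : j ≤ i := Nat.lt_succ_iff.1 (Finset.mem_range.1 hj)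
    have h1 : (d.choose i : ℤ) * i.choose j = d.choose j * (d - j).choose (i - j) := by
      exact_mod_cast Nat.choose_mul hji
    have h2 : (-1 : ℤ) ^ i * (-1) ^ j = (-1) ^ (i - j) := by
      obtain ⟨r, rfl⟩ := Nat.exists_eq_add_of_le hji
      rw [Nat.add_sub_cancel_left, pow_add, mul_right_comm, ← mul_pow]
      simp
    rw [← h2]
    linear_combination (-(-1 : ℤ) ^ i * (-1) ^ j) * h1
  rw [Finset.sum_congr rfl h, ← Finset.mul_sum, Int.alternating_sum_range_choose]
  split_ifs with h0 <;> simp [h0]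

/-- The coefficient form of ∑_{j ≤ e} C(e+1, j) (x-1)^(e-j) = (x^(e+1) - 1)/(x - 1) = x^e + ⋯ + 1.
-/
theorem alternating_sum_choose_mul_choose_succ {e i : ℕ} (hi : i ≤ e) :
    ∑ j ∈ Finset.range (i + 1),
      (-1 : ℤ) ^ (i - j) * ((e - j).choose (i - j) : ℤ) * (e + 1).choose j = 1 := by
  induction i generalizing e with
  | zero => simp
  | succ i ih =>
    obtain ⟨e, rfl⟩ : ∃ e', e = e' + 1 := ⟨e - 1, by omega⟩
    have hX := alternating_sum_choose_mul_choose hi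
    rw [Finset.sum_range_succ'] at hX ⊢
    simp only [Nat.add_sub_add_right, Nat.choose_zero_right, Nat.choose_succ_succ' (e + 1),
      Nat.cast_add, mul_add, Finset.sum_add_distrib] at hX ⊢
    -- Pascal's rule splits the sum into the induction hypothesis, equal to 1, and the preceding
    -- identity at a positive index, equal to 0.
    rw [ih (by omega), add_assoc, hX]
    simp

theorem hVector_stackedPolytope (hm : 1 ≤ m) (hk : 1 ≤ k) {i : ℕ} (hi : i ≤ m + 1) :
    hVector (boundaryComplex (stackedPolytope m k)) (m + 1) i =
      (if i = 0 then 1 else 0) + k * (if i = 0 then 0 else 1) -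
        (k - 1) * (if i = m + 1 then 1 else 0) := by
  have hX := alternating_sum_choose_mul_choose hi
  have hY : ∑ j ∈ Finset.range (i + 1), (-1 : ℤ) ^ (i - j) *
      ((m + 1 - j).choose (i - j) : ℤ) * (if j = 0 then 0 else ((m + 1).choose (j - 1) : ℤ)) =
      if i = 0 then 0 else 1 := by
    rcases i with _ | i
    · simp
    · have hG := alternating_sum_choose_mul_choose_succ (show i ≤ m by omega)
      rw [Finset.sum_range_succ']
      simpa using hG
  have hZ : ∑ j ∈ Finset.range (i + 1), (-1 : ℤ) ^ (i - j) *
      ((m + 1 - j).choose (i - j) : ℤ) * (if j = m + 1 then 1 else 0) =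
      if i = m + 1 then 1 else 0 := by
    split_ifs with h
    · subst h
      rw [Finset.sum_eq_single (m + 1)]
      · simp
      · intro j _ hj
        simp [hj]
      · simp
    · refine Finset.sum_eq_zero fun j hj => ?_
      have := Finset.mem_range.1 hj
      rw [if_neg (by omega), mul_zero]
  rw [← hX, ← hY, ← hZ, hVector, Finset.mul_sum, Finset.mul_sum, ← Finset.sum_add_distrib,
    ← Finset.sum_sub_distrib]
  refine Finset.sum_congr rfl fun j hj => ?_
  rw [faceCount_stackedPolytope hm hk (by have := Finset.mem_range.1 hj; omega)]
  ring

end LatticePolytope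

theorem theorem2p4 (d : ℕ) (hd : 2 ≤ d) (h₁ : ℕ) (hh : 1 ≤ h₁) :
    ∃ P : Set (Fin d → ℝ),
      LatticePolytope.IsIntegralPolytope P ∧
      LatticePolytope.IsSimplicialPolytope P ∧
      LatticePolytope.dimension P = d ∧
      (∀ F, LatticePolytope.IsFacet P F → LatticePolytope.normalizedVolume F = 1) ∧
      LatticePolytope.hVector (LatticePolytope.boundaryComplex P) d 0 = 1 ∧
      (∀ i, 1 ≤ i → i < d →
        LatticePolytope.hVector (LatticePolytope.boundaryComplex P) d i = (h₁ : ℤ)) ∧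
      LatticePolytope.hVector (LatticePolytope.boundaryComplex P) d d = 1 := by
  obtain ⟨m, rfl⟩ : ∃ m, d = m + 1 := ⟨d - 1, by omega⟩
  have hm : 1 ≤ m := by omega
  refine ⟨LatticePolytope.stackedPolytope m h₁,
    LatticePolytope.isIntegralPolytope_stackedPolytope,
    LatticePolytope.isSimplicialPolytope_stackedPolytope hm hh,
    LatticePolytope.dimension_stackedPolytope hh,
    fun F hF => LatticePolytope.normalizedVolume_facet_stackedPolytope hm hh hF, ?_, ?_, ?_⟩
  · rw [LatticePolytope.hVector_stackedPolytope hm hh (by omega)]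
    simp
  · intro i hi hid
    rw [LatticePolytope.hVector_stackedPolytope hm hh hid.le, if_neg (by omega),
      if_neg (by omega), if_neg (by omega)]
    simp
  · rw [LatticePolytope.hVector_stackedPolytope hm hh le_rfl]
    simp
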